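/- For sets $X, Y \subseteq \mathbb{N}$ write $X =^* Y$ if the symmetric difference $X \triangle Y$ is finite, and write $\overline{X} = \mathbb{N} \setminus X$. A set has c.e. degree if it is Turing equivalent to some computably enumerable (c.e.) set. A separator of $A$ and $B$ is a set $X$ with $A \subseteq X$ and $B \subseteq \overline{X}$. Two c.e. sets $A, B$ form a super-maximal pair if $A \cap B = \emptyset$, $\mathbb{N} \setminus (A \cup B)$ is infinite, and every separator $X$ of $A$ and $B$ of c.e. degree satisfies $X =^* A$ or $\overline{X} =^* B$. Theorem. Let $A$ and $B$ be disjoint c.e. sets such that $\mathbb{N} \setminus (A \cup B)$ is infinite. Then there is a separator $X$ of $A$ and $B$ of c.e. degree such that $X \neq^* A$ and $\overline{X} \neq^* B$. Consequently, super-maximal pairs do not exist. -/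

import Mathlib

/-- `A ⊆ ℕ` is computably enumerable. -/
def IsCE (A : Set ℕ) : Prop := REPred fun n : ℕ => n ∈ A

open Classical in
/-- The characteristic function of `X ⊆ ℕ`, as a (total) element of `ℕ →. ℕ`. -/
noncomputable def charFn (X : Set ℕ) : ℕ →. ℕ :=
  fun n => Part.some (if n ∈ X then 1 else 0)

/-- `X` has c.e. Turing degree: it is Turing equivalent to some c.e. set. -/
def HasCEDegree (X : Set ℕ) : Prop :=
  ∃ W : Set ℕ, IsCE W ∧ TuringEquivalent (charFn X) (charFn W)

/-- `X =* Y`: the two sets differ on only finitely many elements. -/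
def EqStar (X Y : Set ℕ) : Prop := (symmDiff X Y).Finite

/-- `X` separates `A` from `B`: `A ⊆ X` and `B` is contained in the complement of `X`. -/
def IsSeparator (A B X : Set ℕ) : Prop := A ⊆ X ∧ B ⊆ Xᶜ

/-- Super-maximal pairs of sets. -/
structure IsSuperMaximalPair (A B : Set ℕ) : Prop where
  ce_left : IsCE A
  ce_right : IsCE B
  disjoint : A ∩ B = ∅
  infinite_compl : (A ∪ B)ᶜ.Infinite
  eqStar_of_separator : ∀ X : Set ℕ, HasCEDegree X → IsSeparator A B X →
    EqStar X A ∨ EqStar Xᶜ B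

/-! Four separators of `A` and `B` are built at once, and one of them works. The label of `n`
records its membership in all four. A number not yet seen in `A ∪ B` carries a live label, with two
values true and two false. Consecutive live labels are kept compatible, that is, neither equal nor
complementary. If every one of the four sets were eventually constant on `(A ∪ B)ᶜ`, the labels
there would eventually be equal, against compatibility (`Enumerates.exists_infinite`).

When a number with label `v` enters side `b` (true for `A`, false for `B`), its label becomes
constantly `b`, and its live neighbours `u` and `w` may clash. The repair touches only the two sets
with `v i ≠ b`: their values are exchanged at all larger numbers. This removes the clash
(`Label.compat_swap`) and preserves the compatibilities further on (`Label.Compat.swap`).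

Thus the `i`-th set changes at `n` only when some `k ≤ n` is moved for good from the wrong side to
the right one (`Enumerates.of_row_ne`). Its approximation never returns to an initial segment it has
left, so its degree is c.e. (`hasCEDegree_of_approx`). -/

/-- A c.e. set has a primitive recursive enumeration. -/
theorem IsCE.exists_primrec_stage {A : Set ℕ} (hA : IsCE A) :
    ∃ a : ℕ → ℕ → Bool, Primrec₂ a ∧ ∀ n, n ∈ A ↔ ∃ t, a n t = true := by
  obtain ⟨c, hc⟩ := Nat.Partrec.Code.exists_code.1 hA
  refine ⟨fun n t => (c.evaln t n).isSome, ?_, fun n => ?_⟩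
  · exact Primrec.option_isSome.comp (Nat.Partrec.Code.primrec_evaln.comp
      (Primrec.pair (Primrec.pair Primrec.snd (Primrec.const c)) Primrec.fst))
  · have h : n ∈ A ↔ ∃ x, x ∈ c.eval n := by
      rw [hc]
      simp
    rw [h, exists_congr fun x => Nat.Partrec.Code.evaln_complete, exists_comm]
    simp [Option.isSome_iff_exists]

/-! ### Relative computability and searches -/

namespace Nat.RecursiveIn

variable {O : Set (ℕ →. ℕ)}

theorem comp_total {f g : ℕ → ℕ} (hf : Nat.RecursiveIn O fun n => Part.some (f n))
    (hg : Nat.RecursiveIn O fun n => Part.some (g n)) :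
    Nat.RecursiveIn O fun n => Part.some (f (g n)) :=
  (hf.comp hg).of_eq fun n => by simp

theorem pair_total {f g : ℕ → ℕ} (hf : Nat.RecursiveIn O fun n => Part.some (f n))
    (hg : Nat.RecursiveIn O fun n => Part.some (g n)) :
    Nat.RecursiveIn O fun n => Part.some (Nat.pair (f n) (g n)) :=
  (hf.pair hg).of_eq fun n => by simp [Seq.seq]

theorem of_primrec {f : ℕ → ℕ} (hf : Primrec f) : Nat.RecursiveIn O fun n => Part.some (f n) :=
  (Primrec.nat_iff.1 hf).recursiveIn

/-- The initial segments of a function are recursive in it. -/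
theorem initSeg {f : ℕ → Bool} (hf : Nat.RecursiveIn O fun n => Part.some (f n).toNat) :
    Nat.RecursiveIn O fun n => Part.some (Encodable.encode ((List.range n).map f)) := by
  let app : ℕ → ℕ := fun p =>
    Encodable.encode (((Encodable.decode (α := List Bool) p.unpair.1).getD []) ++
      [decide (p.unpair.2 = 1)])
  have happ : Primrec app := by
    refine Primrec.encode.comp (Primrec.list_append.comp ?_ ?_)
    · exact Primrec.option_getD.comp (Primrec.decode.comp (Primrec.fst.comp Primrec.unpair))
        (_root_.Primrec.const [])
    · exact Primrec.list_cons.comp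
        (Primrec.eq.decide.comp (Primrec.snd.comp Primrec.unpair) (_root_.Primrec.const 1))
        (_root_.Primrec.const [])
  have hy : Primrec fun p : ℕ => p.unpair.2.unpair.1 :=
    Primrec.fst.comp (Primrec.unpair.comp (Primrec.snd.comp Primrec.unpair))
  have hi : Primrec fun p : ℕ => p.unpair.2.unpair.2 :=
    Primrec.snd.comp (Primrec.unpair.comp (Primrec.snd.comp Primrec.unpair))
  have hstep := comp_total (of_primrec happ)
    (pair_total (of_primrec hi) (comp_total hf (of_primrec hy)))
  have hrec := (of_primrec (O := O) (_root_.Primrec.const (Encodable.encode ([] : List Bool)))).prec hstep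
  -- The recursion scheme expects a parameter; `0` is a dummy.
  have hin : Primrec fun n : ℕ => Nat.pair 0 n := Primrec₂.natPair.comp (_root_.Primrec.const 0) _root_.Primrec.id
  refine (hrec.comp (of_primrec hin)).of_eq fun n => ?_
  simp only [Part.bind_eq_bind, Part.bind_some, Nat.unpair_pair]
  induction n with
  | zero => simp
  | succ n ih =>
    refine (congrArg (fun q : Part ℕ => q.bind _) ih).trans ?_
    cases h : f n <;> simp [app, h, List.range_succ]

end Nat.RecursiveIn

theorem Nat.exists_rfind_eq_some {p : ℕ → Bool} (h : ∃ n, p n = true) :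
    ∃ n, p n = true ∧ Nat.rfind (fun n => Part.some (p n) : ℕ →. Bool) = Part.some n := by
  obtain ⟨n, hn⟩ := h
  have hdom : (Nat.rfind (fun n => Part.some (p n) : ℕ →. Bool)).Dom :=
    Nat.rfind_dom.2 ⟨n, by simp [hn], fun _ => trivial⟩
  obtain ⟨m, hm⟩ := Part.dom_iff_mem.1 hdom
  exact ⟨m, (Part.mem_some_iff.1 (Nat.rfind_spec hm)).symm, Part.eq_some_iff.2 hm⟩

/-! ### Approximations and c.e. degree -/

/-- Codes of pairs `(s, n)` such that the approximation `f` changes at `n` after stage `s`. -/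
def changeSet (f : ℕ → ℕ → Bool) : Set ℕ :=
  {z | ∃ t, z.unpair.1 ≤ t ∧ f t z.unpair.2 ≠ f z.unpair.1 z.unpair.2}

theorem primrecRel_change {f : ℕ → ℕ → Bool} (hf : Primrec₂ f) :
    PrimrecRel fun t z : ℕ => z.unpair.1 ≤ t ∧ f t z.unpair.2 ≠ f z.unpair.1 z.unpair.2 := by
  have h₁ : Primrec fun q : ℕ × ℕ => q.2.unpair.1 :=
    Primrec.fst.comp (Primrec.unpair.comp Primrec.snd)
  have h₂ : Primrec fun q : ℕ × ℕ => q.2.unpair.2 :=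
    Primrec.snd.comp (Primrec.unpair.comp Primrec.snd)
  exact PrimrecPred.and (Primrec.nat_le.comp h₁ Primrec.fst)
    (PrimrecPred.not (Primrec.eq.comp (hf.comp Primrec.fst h₂) (hf.comp h₁ h₂)))

theorem isCE_changeSet {f : ℕ → ℕ → Bool} (hf : Primrec₂ f) : IsCE (changeSet f) := by
  have h : Partrec fun z : ℕ => Nat.rfind fun t => Part.some
      (decide (z.unpair.1 ≤ t ∧ f t z.unpair.2 ≠ f z.unpair.1 z.unpair.2)) :=
    Partrec.rfind ((primrecRel_change hf).comp Primrec.snd Primrec.fst).decide.to_comp.partrec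
  refine h.dom_re.of_eq fun z => ⟨fun hz => ?_, fun ⟨t, ht⟩ => ?_⟩
  · obtain ⟨t, ht⟩ := Part.dom_iff_mem.1 hz
    exact ⟨t, by simpa using Nat.rfind_spec ht⟩
  · obtain ⟨m, -, hm⟩ := Nat.exists_rfind_eq_some (p := fun t =>
      decide (z.unpair.1 ≤ t ∧ f t z.unpair.2 ≠ f z.unpair.1 z.unpair.2)) ⟨t, by simpa using ht⟩
    exact hm ▸ trivial

/-- Search for a stage `s` with `(s, n)` outside the change set: from then on the value at `n` is
final. -/
theorem turingReducible_changeSet {X : Set ℕ} {f : ℕ → ℕ → Bool} (hf : Primrec₂ f)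
    (hlim : ∀ n, ∃ s, ∀ t, s ≤ t → (f t n = true ↔ n ∈ X)) :
    TuringReducible (charFn X) (charFn (changeSet f)) := by
  classical
  set W := changeSet f with hW
  have hfst : Primrec fun p : ℕ => p.unpair.1 := Primrec.fst.comp Primrec.unpair
  have hsnd : Primrec fun p : ℕ => p.unpair.2 := Primrec.snd.comp Primrec.unpair
  have hor : Nat.RecursiveIn {charFn W} fun n => Part.some (if n ∈ W then 1 else 0) :=
    (Nat.RecursiveIn.oracle (charFn W) rfl : Nat.RecursiveIn {charFn W} (charFn W)).of_eq
      fun n => by simp [charFn]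
  have hq : Nat.RecursiveIn {charFn W} fun p =>
      Part.some (if Nat.pair p.unpair.2 p.unpair.1 ∈ W then 1 else 0) :=
    hor.comp_total (.of_primrec (Primrec₂.natPair.comp hsnd hfst))
  have hout : Primrec fun p : ℕ => (f p.unpair.2 p.unpair.1).toNat :=
    (Primrec.dom_finite Bool.toNat).comp (hf.comp hsnd hfst)
  have hid : Nat.RecursiveIn {charFn W} fun n => Part.some n := .of_primrec Primrec.id
  refine RecursiveIn.iff_nat.2 (((Nat.RecursiveIn.of_primrec hout).comp
    (hid.pair hq.rfind)).of_eq fun n => ?_)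
  obtain ⟨s₀, hs₀⟩ := hlim n
  have hex : Nat.pair s₀ n ∉ W := by
    rintro ⟨t, ht, hne⟩
    simp only [Nat.unpair_pair] at ht hne
    exact hne (Bool.eq_iff_iff.2 ((hs₀ t ht).trans (hs₀ s₀ le_rfl).symm))
  obtain ⟨s, hs, hrs⟩ := Nat.exists_rfind_eq_some (p := fun m => !decide (Nat.pair m n ∈ W))
    ⟨s₀, by simpa using hex⟩
  have hsX : f s n = true ↔ n ∈ X := by
    have h' : f (max s s₀) n = f s n := by
      by_contra hne
      have : Nat.pair s n ∈ W := ⟨max s s₀, by simpa using hne⟩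
      simp [this] at hs
    rw [← h']
    exact hs₀ (max s s₀) (le_max_right _ _)
  simp only [Seq.seq, charFn]
  simp [hrs]
  by_cases hn : n ∈ X
  · simp [hn, hsX.2 hn]
  · simp [hn, Bool.eq_false_iff.2 (mt hsX.1 hn)]

/-- Given `(s, n)`, the oracle `X` finds a stage `t ≥ s` that is correct up to `n`. By `hret`
nothing up to `n` changes after `t`, so only the stages up to `t` need checking. -/
theorem changeSet_turingReducible {X : Set ℕ} {f : ℕ → ℕ → Bool} (hf : Primrec₂ f)
    (hlim : ∀ n, ∃ s, ∀ t, s ≤ t → ∀ k < n, (f t k = true ↔ k ∈ X))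
    (hret : ∀ s m, m ≤ s → (∀ n < m, (f s n = true ↔ n ∈ X)) →
      ∀ t, s ≤ t → ∀ n < m, (f t n = true ↔ n ∈ X)) :
    TuringReducible (charFn (changeSet f)) (charFn X) := by
  classical
  have hlist : ∀ (g : ℕ → Bool) (m : ℕ),
      (List.range m).map g = (List.range m).map (fun n => decide (n ∈ X)) ↔
        ∀ n < m, (g n = true ↔ n ∈ X) := by
    intro g m
    rw [List.map_inj_left]
    simp only [List.mem_range]
    refine forall₂_congr fun n _ => ?_
    by_cases h : n ∈ X <;> simp [h]
  -- The second bound is the condition `m ≤ s` of `hret`, for `m = n + 1`.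
  let P : ℕ × List Bool → ℕ → Prop := fun p t =>
    p.1.unpair.1 ≤ t ∧ p.1.unpair.2 + 1 ≤ t ∧ (List.range (p.1.unpair.2 + 1)).map (f t) = p.2
  have hP : PrimrecRel P := by
    have hz : Primrec fun q : (ℕ × List Bool) × ℕ => q.1.1.unpair :=
      Primrec.unpair.comp (Primrec.fst.comp Primrec.fst)
    have hn : Primrec fun q : (ℕ × List Bool) × ℕ => q.1.1.unpair.2 + 1 :=
      Primrec.succ.comp (Primrec.snd.comp hz)
    refine PrimrecPred.and ?_ (PrimrecPred.and ?_ ?_)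
    · exact Primrec.nat_le.comp (Primrec.fst.comp hz) Primrec.snd
    · exact Primrec.nat_le.comp hn Primrec.snd
    · exact Primrec.eq.comp (Primrec.list_map (Primrec.list_range.comp hn)
        (hf.comp (Primrec.snd.comp Primrec.fst) Primrec.snd)) (Primrec.snd.comp Primrec.fst)
  let E : ℕ → ℕ → Prop := fun t z =>
    ∃ u < t, z.unpair.1 ≤ u ∧ f u z.unpair.2 ≠ f z.unpair.1 z.unpair.2
  have hE : PrimrecRel E := (primrecRel_change hf).exists_lt
  let Φ : ℕ × List Bool →. ℕ := fun p =>
    (Nat.rfind fun t => Part.some (decide (P p t))).map fun t => if E (t + 1) p.1 then 1 else 0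
  have hsearch : Partrec fun p : ℕ × List Bool => Nat.rfind fun t => Part.some (decide (P p t)) :=
    Partrec.rfind hP.decide.to_comp.partrec
  have hΦ : Partrec Φ := by
    refine hsearch.map ?_
    exact (Primrec.ite (hE.comp (Primrec.succ.comp Primrec.snd) (Primrec.fst.comp Primrec.fst))
      (Primrec.const 1) (Primrec.const 0)).to_comp
  have hX : Nat.RecursiveIn {charFn X} fun n => Part.some (decide (n ∈ X)).toNat :=
    (Nat.RecursiveIn.oracle (charFn X) rfl : Nat.RecursiveIn {charFn X} (charFn X)).of_eq
      fun n => by by_cases h : n ∈ X <;> simp [charFn, h]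
  have hin : Nat.RecursiveIn {charFn X} fun z => Part.some (Encodable.encode
      (z, (List.range (z.unpair.2 + 1)).map fun n => decide (n ∈ X))) := by
    have hz' : Primrec fun z : ℕ => z.unpair.2 + 1 :=
      Primrec.succ.comp (Primrec.snd.comp Primrec.unpair)
    exact Nat.RecursiveIn.pair_total (.of_primrec Primrec.id)
      (Nat.RecursiveIn.comp_total hX.initSeg (.of_primrec hz'))
  refine RecursiveIn.iff_nat.2 ((Nat.RecursiveIn.comp hΦ.recursiveIn hin).of_eq fun z => ?_)
  obtain ⟨s₀, hs₀⟩ := hlim (z.unpair.2 + 1)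
  obtain ⟨t, ht, hrt⟩ := Nat.exists_rfind_eq_some (p := fun t => decide (P
      (z, (List.range (z.unpair.2 + 1)).map fun n => decide (n ∈ X)) t))
    ⟨max s₀ (max z.unpair.1 (z.unpair.2 + 1)), by
      simp only [P, hlist, decide_eq_true_eq]
      exact ⟨by simp, by simp, hs₀ _ (le_max_left _ _)⟩⟩
  simp only [P, hlist, decide_eq_true_eq] at ht
  have hiff : z ∈ changeSet f ↔ E (t + 1) z := by
    refine ⟨fun ⟨u, hu, hne⟩ => ?_, fun ⟨u, _, hu⟩ => ⟨u, hu⟩⟩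
    rcases le_or_gt u t with hut | hut
    · exact ⟨u, by omega, hu, hne⟩
    -- The values at `t` and at `u` both agree with `X`, so `t` itself witnesses the change.
    · refine ⟨t, by omega, ht.1, fun h => hne ?_⟩
      rw [← h]
      exact Bool.eq_iff_iff.2 ((hret t _ ht.2.1 ht.2.2 u hut.le _ (by omega)).trans
        (ht.2.2 _ (by omega)).symm)
  simp [Φ, hrt, charFn, hiff]

/-- A set with a primitive recursive approximation that never returns to an initial segment
it has left has c.e. degree. -/
theorem hasCEDegree_of_approx {X : Set ℕ} {f : ℕ → ℕ → Bool} (hf : Primrec₂ f)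
    (hlim : ∀ n, ∃ s, ∀ t, s ≤ t → ∀ k < n, (f t k = true ↔ k ∈ X))
    (hret : ∀ s m, m ≤ s → (∀ n < m, (f s n = true ↔ n ∈ X)) →
      ∀ t, s ≤ t → ∀ n < m, (f t n = true ↔ n ∈ X)) :
    HasCEDegree X :=
  ⟨changeSet f, isCE_changeSet hf,
    turingReducible_changeSet hf fun n =>
      (hlim (n + 1)).imp fun _ hs t ht => hs t ht n n.lt_succ_self,
    changeSet_turingReducible hf hlim hret⟩

/-! ### Labels and swaps -/

/-- A label records the values of four sets at one number. -/
abbrev Label := Fin 4 → Bool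

namespace Label

/-- A label is live if exactly two of its values are `true`. -/
def Live (v : Label) : Prop := (Finset.univ.filter fun i => v i = true).card = 2

instance : DecidablePred Live := fun v => by unfold Live; infer_instance

/-- Two labels are compatible if they are neither equal nor complementary. -/
def Compat (v w : Label) : Prop := w ≠ v ∧ w ≠ fun i => !v i

instance : DecidableRel Compat := fun v w => by unfold Compat; infer_instance

/-- For live `v`, exchange the values of `w` at the two indices where `v` differs from `b`. -/
def swap (v : Label) (b : Bool) (w : Label) : Label := fun i =>
  if v i = b then w i else decide (∃ j, j ≠ i ∧ v j = v i ∧ w j = true)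

theorem swap_apply_of_eq {v : Label} {b : Bool} {i : Fin 4} (h : v i = b) (w : Label) :
    swap v b w i = w i := if_pos h

/-- For live `v`, `swap v b` is a transposition of coordinates, so it preserves liveness, constants
and compatibility. -/
theorem live_swap : ∀ {v : Label}, v.Live → ∀ b w, (swap v b w).Live ↔ w.Live := by
  decide +kernel

theorem swap_const : ∀ {v : Label}, v.Live → ∀ b c, swap v b (fun _ => c) = fun _ => c := by
  decide +kernel

theorem Compat.swap : ∀ {v : Label}, v.Live → ∀ b, ∀ {w : Label}, w.Live → ∀ {w' : Label}, w'.Live →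
    Compat w w' → Compat (swap v b w) (swap v b w') := by
  decide +kernel

/-- Here `w` is `u` or its complement. Being compatible with `v`, it takes both values on each of
the two pairs into which `v` splits the indices. Exchanging one pair yields neither `u` nor its
complement. -/
theorem compat_swap : ∀ {v : Label}, v.Live → ∀ {u : Label}, u.Live → ∀ {w : Label}, w.Live →
    Compat u v → Compat v w → ¬ Compat u w → ∀ b, Compat u (Label.swap v b w) := by
  decide +kernel

end Label

/-! ### Lists of labels, deaths and repairs -/

/-- The label at position `n`, a dead one if `n` is out of range. -/
def labelAt (L : List Label) (n : ℕ) : Label := L.getD n fun _ => false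

/-- The last live label before position `n` and the first live one after it are incompatible. -/
def Clash (L : List Label) (n : ℕ) : Prop :=
  ∃ u ∈ ((L.take n).filter (·.Live)).getLast?, ∃ w ∈ ((L.drop (n + 1)).filter (·.Live)).head?,
    ¬ u.Compat w

/-- The map applied to the labels beyond `n` when `n` is declared dead. -/
noncomputable def repair (L : List Label) (n : ℕ) (b : Bool) : Label → Label :=
  open Classical in if Clash L n then Label.swap (labelAt L n) b else id

/-- If the label at `n` is live, make it constantly `b` and repair the labels beyond `n`. -/
noncomputable def kill (L : List Label) (n : ℕ) (b : Bool) : List Label :=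
  if (labelAt L n).Live then
    L.take n ++ (fun _ => b) :: (L.drop (n + 1)).map (repair L n b)
  else L

/-- A live label compatible with the last live label of the list. -/
def fresh (L : List Label) : Label :=
  if ∃ u ∈ (L.filter (·.Live)).getLast?, ¬ u.Compat ![true, true, false, false] then
    ![true, false, true, false]
  else ![true, true, false, false]

theorem not_live_const : ∀ b : Bool, ¬ Label.Live fun _ => b := by decide

theorem lt_length_of_live {L : List Label} {n : ℕ} (h : (labelAt L n).Live) : n < L.length := by
  by_contra hn
  rw [labelAt, List.getD_eq_default _ _ (not_lt.1 hn)] at h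
  exact not_live_const _ h

theorem length_kill (L : List Label) (n : ℕ) (b : Bool) : (kill L n b).length = L.length := by
  rw [kill]
  split_ifs with h
  · have := lt_length_of_live h
    simp
    omega
  · rfl

theorem repair_eq_or (L : List Label) (n : ℕ) (b : Bool) :
    repair L n b = id ∨ repair L n b = Label.swap (labelAt L n) b := by
  rw [repair]
  split_ifs <;> simp

theorem labelAt_kill_of_lt (L : List Label) {n m : ℕ} (b : Bool) (hm : m < n) :
    labelAt (kill L n b) m = labelAt L m := by
  rw [kill]
  split_ifs with h
  · have := lt_length_of_live h
    rw [labelAt, List.getD_append _ _ _ _ (by simp; omega)]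
    simp [labelAt, List.getD_eq_getElem?_getD, hm]
  · rfl

theorem labelAt_kill_self {L : List Label} {n : ℕ} (b : Bool) (h : (labelAt L n).Live) :
    labelAt (kill L n b) n = fun _ => b := by
  have := lt_length_of_live h
  rw [kill, if_pos h, labelAt, List.getD_append_right _ _ _ _ (by simp)]
  simp [this.le]

theorem labelAt_kill_of_gt {L : List Label} {n m : ℕ} (b : Bool) (h : (labelAt L n).Live)
    (hm : n < m) : labelAt (kill L n b) m = repair L n b (labelAt L m) := by
  have := lt_length_of_live h
  obtain ⟨k, rfl⟩ := Nat.exists_eq_add_of_lt hm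
  -- The repair fixes the default label, so it commutes with lookup even past the end of the list.
  have hd : repair L n b (fun _ => false) = fun _ => false := by
    rcases repair_eq_or L n b with h' | h' <;> rw [h']
    · rfl
    · exact Label.swap_const h _ _
  rw [kill, if_pos h, labelAt, List.getD_append_right _ _ _ _ (by simp; omega)]
  have e : n + k + 1 - (L.take n).length = k + 1 := by simp; omega
  rw [e, List.getD_cons_succ]
  conv_lhs => rw [← hd]
  rw [List.getD_map]
  simp [labelAt, List.getD_eq_getElem?_getD, Nat.add_right_comm]

theorem live_repair {L : List Label} {n : ℕ} (b : Bool) (h : (labelAt L n).Live) (w : Label) :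
    (repair L n b w).Live ↔ w.Live := by
  rcases repair_eq_or L n b with h' | h' <;> rw [h']
  · rfl
  · exact Label.live_swap h b w

/-- A set that already has the dying number on the correct side is left intact everywhere; this is
what makes the degrees c.e. -/
theorem labelAt_kill_apply {L : List Label} {n : ℕ} {b : Bool} {i : Fin 4}
    (h : labelAt L n i = b) (m : ℕ) : labelAt (kill L n b) m i = labelAt L m i := by
  by_cases hl : (labelAt L n).Live
  · rcases lt_trichotomy m n with hm | rfl | hm
    · rw [labelAt_kill_of_lt _ _ hm]
    · rw [labelAt_kill_self _ hl, h]
    · rw [labelAt_kill_of_gt _ hl hm]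
      rcases repair_eq_or L n b with h' | h' <;> rw [h']
      · rfl
      · exact Label.swap_apply_of_eq h _
  · rw [kill, if_neg hl]

theorem labelAt_kill_const {L : List Label} {m : ℕ} {c : Bool} (h : labelAt L m = fun _ => c)
    (n : ℕ) (b : Bool) : labelAt (kill L n b) m = fun _ => c := by
  by_cases hl : (labelAt L n).Live
  · rcases lt_trichotomy m n with hm | rfl | hm
    · rw [labelAt_kill_of_lt _ _ hm, h]
    · exact absurd (h ▸ hl) (not_live_const c)
    · rw [labelAt_kill_of_gt _ hl hm, h]
      rcases repair_eq_or L n b with h' | h' <;> rw [h']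
      · rfl
      · exact Label.swap_const hl _ _
  · rw [kill, if_neg hl, h]

theorem live_labelAt_kill {L : List Label} {m n : ℕ} (b : Bool) (h : m ≠ n) :
    (labelAt (kill L n b) m).Live ↔ (labelAt L m).Live := by
  by_cases hl : (labelAt L n).Live
  · rcases h.lt_or_gt with hm | hm
    · rw [labelAt_kill_of_lt _ _ hm]
    · rw [labelAt_kill_of_gt _ hl hm, live_repair b hl]
  · rw [kill, if_neg hl]

/-- Consecutive live labels are compatible. -/
def Good (L : List Label) : Prop := (L.filter (·.Live)).IsChain Label.Compat

theorem live_fresh (L : List Label) : (fresh L).Live := by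
  rw [fresh]
  split_ifs <;> decide

theorem good_append_fresh {L : List Label} (h : Good L) : Good (L ++ [fresh L]) := by
  -- The two candidates are compatible with each other, so no live label is incompatible with both.
  have key : ∀ u : Label, u.Live → ¬ u.Compat ![true, true, false, false] →
      u.Compat ![true, false, true, false] := by decide +kernel
  rw [Good, List.filter_append, List.filter_singleton, decide_eq_true (live_fresh L)]
  refine List.isChain_append.2 ⟨h, by simp, fun u hu w hw => ?_⟩
  obtain rfl : fresh L = w := by simpa using hw
  have hu' : u.Live := by
    have := (List.mem_filter.1 (List.mem_of_getLast? hu)).2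
    simpa using this
  rw [fresh]
  split_ifs with hex
  · obtain ⟨u', hu₁, hu₂⟩ := hex
    obtain rfl : u = u' := Option.mem_unique hu hu₁
    exact key u hu' hu₂
  · by_contra hc
    exact hex ⟨u, hu, hc⟩

/-- One map acts on the whole tail, so compatibility can only fail at the junction across `n`, where
the swap restores it. -/
theorem good_kill {L : List Label} (h : Good L) (n : ℕ) (b : Bool) : Good (kill L n b) := by
  rw [kill]
  split_ifs with hl
  swap
  · exact h
  have hlen := lt_length_of_live hl
  have hL : L = L.take n ++ labelAt L n :: L.drop (n + 1) := by
    rw [labelAt, List.getD_eq_getElem _ _ hlen, ← List.drop_eq_getElem_cons hlen,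
      List.take_append_drop]
  have hmap : ((L.drop (n + 1)).map (repair L n b)).filter (·.Live) =
      ((L.drop (n + 1)).filter (·.Live)).map (repair L n b) := by
    rw [List.filter_map]
    congr 1
    refine List.filter_congr fun w _ => ?_
    simp [live_repair b hl]
  have h' := h
  rw [Good, hL, List.filter_append, List.filter_cons_of_pos (by simpa using hl),
    List.isChain_append, List.isChain_cons] at h'
  obtain ⟨h₁, ⟨hv₂, h₂⟩, h₁v⟩ := h'
  rw [Good, List.filter_append, List.filter_cons_of_neg (by simpa using not_live_const b), hmap]
  have hlive : ∀ (l : List Label), ∀ w ∈ l.filter (·.Live), Label.Live w := fun l w hw => by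
    simpa using (List.mem_filter.1 hw).2
  refine List.isChain_append.2 ⟨h₁, ?_, fun u hu w hw => ?_⟩
  · rcases repair_eq_or L n b with hr | hr <;> rw [hr]
    · simpa using h₂
    · rw [List.isChain_map]
      exact h₂.imp_of_mem_imp fun w w' hw hw' hc => hc.swap hl b (hlive _ _ hw) (hlive _ _ hw')
  · obtain ⟨w', hw', rfl⟩ : ∃ w' ∈ ((L.drop (n + 1)).filter (·.Live)).head?,
        repair L n b w' = w := by simpa using hw
    by_cases hc : Clash L n
    · rw [repair, if_pos hc]
      obtain ⟨u₁, hu₁, w₁, hw₁, hne⟩ := hc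
      obtain rfl := Option.mem_unique hu hu₁
      obtain rfl := Option.mem_unique hw' hw₁
      exact Label.compat_swap hl (hlive _ _ (List.mem_of_getLast? hu))
        (hlive _ _ (List.mem_of_head? hw')) (h₁v _ hu _ (by simp)) (hv₂ _ hw') hne b
    · rw [repair, if_neg hc]
      by_contra hne
      exact hc ⟨u, hu, w', hw', hne⟩

/-- In a good list, two live labels with no live label in between are compatible. -/
theorem Good.compat {L : List Label} (h : Good L) {m n : ℕ} (hmn : m < n)
    (hm : (labelAt L m).Live) (hn : (labelAt L n).Live)
    (hbetween : ∀ k, m < k → k < n → ¬ (labelAt L k).Live) :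
    (labelAt L m).Compat (labelAt L n) := by
  have hnl := lt_length_of_live hn
  have hml := lt_length_of_live hm
  have hL : ∀ k < L.length, L.drop k = labelAt L k :: L.drop (k + 1) := fun k hk => by
    rw [labelAt, List.getD_eq_getElem _ _ hk, ← List.drop_eq_getElem_cons hk]
  have hfn : (L.drop n).filter (·.Live) = labelAt L n :: (L.drop (n + 1)).filter (·.Live) := by
    rw [hL n hnl, List.filter_cons_of_pos (by simpa using hn)]
  have hskip : ∀ j, m + 1 + j ≤ n → (L.drop (m + 1)).filter (·.Live) =
      (L.drop (m + 1 + j)).filter (·.Live) := by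
    intro j
    induction j with
    | zero => simp
    | succ j ih =>
      intro hj
      rw [ih (by omega), hL (m + 1 + j) (by omega), List.filter_cons_of_neg
        (by simpa using hbetween (m + 1 + j) (by omega) (by omega))]
      rfl
  have hg := h
  rw [Good, ← List.take_append_drop m L, List.filter_append, hL m hml,
    List.filter_cons_of_pos (by simpa using hm), hskip (n - m - 1) (by omega),
    show m + 1 + (n - m - 1) = n by omega, hfn, List.isChain_append] at hg
  exact (List.isChain_cons.1 hg.2.1).1 _ (by simp)

/-! ### Primitive recursiveness of the list operations -/

section Primrec

theorem primrec_labelAt : Primrec₂ labelAt := Primrec.list_getD _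

theorem primrecPred_live : PrimrecPred Label.Live :=
  ⟨inferInstance, Primrec.dom_finite _⟩

theorem primrec_fresh : Primrec fresh := by
  classical
  let g : Option Label → Label := fun o =>
    if ∃ u ∈ o, ¬ u.Compat ![true, true, false, false] then ![true, false, true, false]
    else ![true, true, false, false]
  refine ((Primrec.dom_finite g).comp (Primrec.list_head?.comp (Primrec.list_reverse.comp
    (Primrec.listFilter primrecPred_live)))).of_eq fun L => ?_
  simp only [g, fresh, List.head?_reverse]
  congr

theorem primrec_kill : Primrec fun p : List Label × ℕ × Bool => kill p.1 p.2.1 p.2.2 := by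
  classical
  have hn : Primrec fun p : List Label × ℕ × Bool => p.2.1 := Primrec.fst.comp Primrec.snd
  have hv : Primrec fun p : List Label × ℕ × Bool => labelAt p.1 p.2.1 :=
    primrec_labelAt.comp Primrec.fst hn
  have htake : Primrec fun p : List Label × ℕ × Bool => p.1.take p.2.1 :=
    Primrec.list_take.comp hn Primrec.fst
  have hdrop : Primrec fun p : List Label × ℕ × Bool => p.1.drop (p.2.1 + 1) :=
    Primrec.list_drop.comp (Primrec.succ.comp hn) Primrec.fst
  have hfilter := Primrec.listFilter primrecPred_live
  let g : (Option Label × Option Label) × (Label × Bool) × Label → Label := fun q =>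
    if ∃ u ∈ q.1.1, ∃ w ∈ q.1.2, ¬ u.Compat w then Label.swap q.2.1.1 q.2.1.2 q.2.2 else q.2.2
  have hrepair : Primrec₂ fun (p : List Label × ℕ × Bool) (w : Label) =>
      repair p.1 p.2.1 p.2.2 w := by
    refine ((Primrec.dom_finite g).comp (Primrec.pair (Primrec.pair
      ((Primrec.list_head?.comp (Primrec.list_reverse.comp (hfilter.comp htake))).comp Primrec.fst)
      ((Primrec.list_head?.comp (hfilter.comp hdrop)).comp Primrec.fst))
      (Primrec.pair (Primrec.pair (hv.comp Primrec.fst)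
        (Primrec.snd.comp (Primrec.snd.comp Primrec.fst))) Primrec.snd))).of_eq fun q => ?_
    by_cases h : Clash q.1.1 q.1.2.1
    · simp only [g, repair, if_pos h, List.head?_reverse]
      exact if_pos h
    · simp only [g, repair, if_neg h, List.head?_reverse]
      exact if_neg h
  refine Primrec.ite (primrecPred_live.comp hv) ?_ Primrec.fst
  exact Primrec.list_append.comp htake (Primrec.list_cons.comp
    ((Primrec.dom_finite fun b : Bool => (fun _ => b : Label)).comp
      (Primrec.snd.comp Primrec.snd)) (Primrec.list_map hdrop hrepair))

end Primrec

/-! ### The construction by stages -/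

/-- The side, if any, that `s.unpair.1` is seen to enter at stage `s`. -/
def event (e : Bool → ℕ → ℕ → Bool) (s : ℕ) : Option Bool :=
  if e true s.unpair.1 s.unpair.2 then some true
  else if e false s.unpair.1 s.unpair.2 then some false
  else none

/-- The labels of the numbers below `s` at stage `s`. -/
noncomputable def row (e : Bool → ℕ → ℕ → Bool) : ℕ → List Label
  | 0 => []
  | s + 1 =>
    (event e s).elim (row e s ++ [fresh (row e s)])
      (kill (row e s ++ [fresh (row e s)]) s.unpair.1)

theorem primrec_row {e : Bool → ℕ → ℕ → Bool} (he : ∀ c, Primrec₂ (e c)) : Primrec (row e) := by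
  have hev : Primrec (event e) := by
    have h : ∀ c, Primrec fun s : ℕ => e c s.unpair.1 s.unpair.2 := fun c =>
      (he c).comp (Primrec.fst.comp Primrec.unpair) (Primrec.snd.comp Primrec.unpair)
    exact Primrec.ite (Primrec.eq.comp (h true) (Primrec.const true)) (Primrec.const _)
      (Primrec.ite (Primrec.eq.comp (h false) (Primrec.const true)) (Primrec.const _)
        (Primrec.const _))
  have happ : Primrec fun L : List Label => L ++ [fresh L] :=
    Primrec.list_concat.comp Primrec.id primrec_fresh
  have hstep : Primrec₂ fun (s : ℕ) (L : List Label) =>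
      (event e s).elim (L ++ [fresh L]) (kill (L ++ [fresh L]) s.unpair.1) := by
    have hk : Primrec₂ fun (q : ℕ × List Label) (c : Bool) =>
        kill (q.2 ++ [fresh q.2]) q.1.unpair.1 c :=
      primrec_kill.comp (Primrec.pair (happ.comp (Primrec.snd.comp Primrec.fst))
        (Primrec.pair (Primrec.fst.comp (Primrec.unpair.comp (Primrec.fst.comp Primrec.fst)))
          Primrec.snd))
    refine (Primrec.option_casesOn (hev.comp Primrec.fst) (happ.comp Primrec.snd) hk).of_eq
      fun q => ?_
    rcases q with ⟨s, L⟩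
    dsimp only
    cases event e s <;> rfl
  refine (Primrec.nat_rec₁ [] hstep).of_eq fun s => ?_
  induction s with
  | zero => rfl
  | succ s ih => simp only [row, ← ih]

theorem length_row (e : Bool → ℕ → ℕ → Bool) (s : ℕ) : (row e s).length = s := by
  induction s with
  | zero => rfl
  | succ s ih => cases h : event e s <;> simp [row, h, length_kill, ih]

theorem good_row (e : Bool → ℕ → ℕ → Bool) (s : ℕ) : Good (row e s) := by
  induction s with
  | zero => simp [Good, row]
  | succ s ih =>
    cases h : event e s
    · simpa [row, h] using good_append_fresh ih
    · simpa [row, h] using good_kill (good_append_fresh ih) _ _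

theorem labelAt_append_of_lt {L : List Label} {n : ℕ} (h : n < L.length) (v : Label) :
    labelAt (L ++ [v]) n = labelAt L n := List.getD_append _ _ _ _ h

theorem labelAt_append_length (L : List Label) (v : Label) :
    labelAt (L ++ [v]) L.length = v := by
  simp [labelAt]

/-! ### Convergence and verification -/

/-- `e c` enumerates `S c`, and the two sets are disjoint. -/
structure Enumerates (e : Bool → ℕ → ℕ → Bool) (S : Bool → Set ℕ) : Prop where
  mem_iff : ∀ c n, n ∈ S c ↔ ∃ t, e c n t = true
  eq_of_mem : ∀ {c c' n}, n ∈ S c → n ∈ S c' → c = c'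

/-- The labels converge to `x`. -/
def IsLimit (e : Bool → ℕ → ℕ → Bool) (x : ℕ → Label) : Prop :=
  ∀ n, ∃ s, n ≤ s ∧ ∀ t, s ≤ t → ∀ k < n, labelAt (row e t) k = x k

namespace Enumerates

variable {e : Bool → ℕ → ℕ → Bool} {S : Bool → Set ℕ}

theorem mem_of_event (h : Enumerates e S) {s : ℕ} {c : Bool} (hs : event e s = some c) :
    s.unpair.1 ∈ S c := by
  rw [event] at hs
  split_ifs at hs with h₁ h₂
  · obtain rfl : true = c := by simpa using hs
    exact (h.mem_iff _ _).2 ⟨_, h₁⟩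
  · obtain rfl : false = c := by simpa using hs
    exact (h.mem_iff _ _).2 ⟨_, h₂⟩

theorem exists_event (h : Enumerates e S) {n : ℕ} {c : Bool} (hn : n ∈ S c) :
    ∃ s, s.unpair.1 = n ∧ event e s = some c := by
  obtain ⟨t, ht⟩ := (h.mem_iff c n).1 hn
  refine ⟨Nat.pair n t, by simp, ?_⟩
  cases hev : event e (Nat.pair n t) with
  | none =>
    rw [event, Nat.unpair_pair] at hev
    cases c <;> split_ifs at hev
  | some c' =>
    have := h.mem_of_event hev
    rw [Nat.unpair_pair] at this
    rw [h.eq_of_mem hn this]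

theorem live_or_const (h : Enumerates e S) (s : ℕ) : ∀ n < s,
    (labelAt (row e s) n).Live ∨ ∃ c, n ∈ S c ∧ labelAt (row e s) n = fun _ => c := by
  induction s with
  | zero => simp
  | succ s ih =>
    intro n hn
    set L := row e s ++ [fresh (row e s)] with hL
    have hLn : (labelAt L n).Live ∨ ∃ c, n ∈ S c ∧ labelAt L n = fun _ => c := by
      rcases Nat.lt_succ_iff_lt_or_eq.1 hn with hn | rfl
      · rw [labelAt_append_of_lt (by rwa [length_row])]
        exact ih n hn
      · left
        have := labelAt_append_length (row e n) (fresh (row e n))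
        rw [length_row] at this
        rw [this]
        exact live_fresh _
    cases hev : event e s with
    | none => simpa [row, hev] using hLn
    | some c =>
      simp only [row, hev, Option.elim, ← hL]
      by_cases hns : n = s.unpair.1
      · rcases hLn with hl | ⟨c', hc', hl⟩
        · right
          refine ⟨c, hns ▸ h.mem_of_event hev, ?_⟩
          rw [← hns, labelAt_kill_self _ hl]
        · exact Or.inr ⟨c', hc', labelAt_kill_const hl _ _⟩
      · rw [live_labelAt_kill _ hns]
        exact hLn.imp id fun ⟨c', hc', hl⟩ => ⟨c', hc', labelAt_kill_const hl _ _⟩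

theorem row_const_succ {s n : ℕ} {c : Bool} (hn : n < s)
    (hc : labelAt (row e s) n = fun _ => c) : labelAt (row e (s + 1)) n = fun _ => c := by
  have hL : labelAt (row e s ++ [fresh (row e s)]) n = fun _ => c := by
    rw [labelAt_append_of_lt (by rwa [length_row]), hc]
  cases hev : event e s with
  | none => simpa [row, hev] using hL
  | some c' => simpa [row, hev] using labelAt_kill_const hL _ _

theorem row_const_of_le {s t n : ℕ} {c : Bool} (hn : n < s) (hst : s ≤ t)
    (hc : labelAt (row e s) n = fun _ => c) : labelAt (row e t) n = fun _ => c := by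
  induction t, hst using Nat.le_induction with
  | base => exact hc
  | succ t ht ih => exact row_const_succ (hn.trans_le ht) ih

theorem exists_row_const (h : Enumerates e S) {n : ℕ} {c : Bool} (hn : n ∈ S c) :
    ∃ s, n < s ∧ labelAt (row e s) n = fun _ => c := by
  obtain ⟨s, rfl, hev⟩ := h.exists_event hn
  -- The entering number is at most the stage, so it already has a label once the fresh one is
  -- appended.
  have hs : s.unpair.1 < s + 1 := Nat.lt_succ_of_le (Nat.unpair_left_le s)
  refine ⟨s + 1, hs, ?_⟩
  rcases h.live_or_const (s + 1) _ hs with hl | ⟨c', hc', hl⟩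
  · exfalso
    simp only [row, hev, Option.elim] at hl
    by_cases hl' : (labelAt (row e s ++ [fresh (row e s)]) s.unpair.1).Live
    · rw [labelAt_kill_self _ hl'] at hl
      exact not_live_const _ hl
    · rw [kill, if_neg hl'] at hl
      exact hl' hl
  · rw [hl, h.eq_of_mem hn hc']

/-- A value can only change when a smaller or equal number enters the opposite side. -/
theorem of_row_ne (h : Enumerates e S) {s n : ℕ} (hn : n < s) {i : Fin 4}
    (hne : labelAt (row e (s + 1)) n i ≠ labelAt (row e s) n i) :
    ∃ k ≤ n, ∃ c, k ∈ S c ∧ labelAt (row e s) k i ≠ c ∧ (labelAt (row e s) k).Live ∧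
      labelAt (row e (s + 1)) k = fun _ => c := by
  set L := row e s ++ [fresh (row e s)] with hL
  have hLn : ∀ k < s, labelAt L k = labelAt (row e s) k := fun k hk =>
    labelAt_append_of_lt (by rwa [length_row]) _
  cases hev : event e s with
  | none => exact absurd (by simp [row, hev, ← hL, hLn n hn]) hne
  | some c =>
    have hrow : row e (s + 1) = kill L s.unpair.1 c := by simp [row, hev, hL]
    rw [hrow, ← hLn n hn] at hne
    have hl : (labelAt L s.unpair.1).Live := by
      by_contra hl
      exact hne (by rw [kill, if_neg hl])
    have hk : s.unpair.1 ≤ n := by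
      by_contra hk
      exact hne (by rw [labelAt_kill_of_lt _ _ (not_le.1 hk)])
    refine ⟨s.unpair.1, hk, c, h.mem_of_event hev, ?_, ?_, ?_⟩
    · rw [← hLn _ (hk.trans_lt hn)]
      exact fun hc => hne (labelAt_kill_apply hc n)
    · rwa [← hLn _ (hk.trans_lt hn)]
    · rw [hrow, labelAt_kill_self _ hl]

/-- Wait until every number below `n` that ever enters a side is dead. A later change below `n`
would need another such number to be still live. -/
theorem exists_stable (h : Enumerates e S) (n : ℕ) : ∃ s, n ≤ s ∧
    ∀ t, s ≤ t → ∀ k < n, labelAt (row e t) k = labelAt (row e s) k := by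
  have hdead : ∃ s, n ≤ s ∧ ∀ k < n, ∀ c, k ∈ S c → labelAt (row e s) k = fun _ => c := by
    have hk : ∀ k, ∃ s, k < s ∧ ∀ c, k ∈ S c → labelAt (row e s) k = fun _ => c := by
      intro k
      by_cases hk : ∃ c, k ∈ S c
      · obtain ⟨c, hc⟩ := hk
        obtain ⟨s, hs, hs'⟩ := h.exists_row_const hc
        exact ⟨s, hs, fun c' hc' => h.eq_of_mem hc hc' ▸ hs'⟩
      · exact ⟨k + 1, k.lt_succ_self, fun c hc => absurd ⟨c, hc⟩ hk⟩
    choose f hf hf' using hk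
    refine ⟨max n ((Finset.range n).sup f), le_max_left _ _, fun k hk c hc => ?_⟩
    exact row_const_of_le (hf k)
      ((Finset.le_sup (Finset.mem_range.2 hk)).trans (le_max_right _ _)) (hf' k c hc)
  obtain ⟨s, hs, hd⟩ := hdead
  refine ⟨s, hs, fun t ht => ?_⟩
  induction t, ht using Nat.le_induction with
  | base => exact fun _ _ => rfl
  | succ t ht ih =>
    intro k hk
    rw [← ih k hk]
    funext i
    by_contra hne
    obtain ⟨j, hj, c, hjc, -, hlive, -⟩ := h.of_row_ne (by omega) hne
    rw [ih j (by omega), hd j (by omega) c hjc] at hlive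
    exact not_live_const _ hlive

theorem exists_isLimit (h : Enumerates e S) : ∃ x, IsLimit e x := by
  choose s hs hst using h.exists_stable
  refine ⟨fun k => labelAt (row e (s (k + 1))) k, fun n => ⟨s n, hs n, fun t ht k hk => ?_⟩⟩
  rw [hst n t ht k hk, ← hst n (max (s n) (s (k + 1))) (le_max_left _ _) k hk]
  exact hst (k + 1) _ (le_max_right _ _) k k.lt_succ_self

variable {x : ℕ → Label}

theorem limit_eq_const (h : Enumerates e S) (hx : IsLimit e x) {n : ℕ} {c : Bool} (hn : n ∈ S c) :
    x n = fun _ => c := by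
  obtain ⟨s, hs, hs'⟩ := h.exists_row_const hn
  obtain ⟨u, -, hu⟩ := hx (n + 1)
  rw [← hu (max s u) (le_max_right _ _) n n.lt_succ_self]
  exact row_const_of_le hs (le_max_left _ _) hs'

theorem live_limit (h : Enumerates e S) (hx : IsLimit e x) {n : ℕ} (hn : ∀ c, n ∉ S c) : (x n).Live := by
  obtain ⟨u, hu, hu'⟩ := hx (n + 1)
  rw [← hu' u le_rfl n n.lt_succ_self]
  exact (h.live_or_const u n hu).resolve_right fun ⟨c, hc, _⟩ => hn c hc

/-- A change is caused by some `k` whose current value is not its limit, so a correct initial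
segment never changes. -/
theorem hasCEDegree_limit (h : Enumerates e S) (hx : IsLimit e x) (he : ∀ c, Primrec₂ (e c)) (i : Fin 4) :
    HasCEDegree {n | x n i = true} := by
  have hf : Primrec₂ fun t n => labelAt (row e t) n i :=
    (Primrec.dom_finite fun v : Label => v i).comp
      (primrec_labelAt.comp ((primrec_row he).comp Primrec.fst) Primrec.snd)
  refine hasCEDegree_of_approx hf (fun n => ?_) fun s m hms hs t ht => ?_
  · obtain ⟨s, -, hs⟩ := hx n
    exact ⟨s, fun t ht k hk => by rw [hs t ht k hk]; rfl⟩
  · simp only [Set.mem_ofPred_eq, ← Bool.eq_iff_iff] at hs ⊢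
    induction t, ht using Nat.le_induction with
    | base => exact hs
    | succ t ht ih =>
      intro n hn
      by_contra hne
      rw [← ih n hn] at hne
      obtain ⟨k, hk, c, hkc, hk', -, -⟩ := h.of_row_ne (by omega) hne
      rw [ih k (by omega), h.limit_eq_const hx hkc] at hk'
      exact hk' rfl

theorem exists_infinite (h : Enumerates e S) (hx : IsLimit e x) {C : Set ℕ} (hC : C.Infinite)
    (hCS : ∀ n, n ∈ C ↔ ∀ c, n ∉ S c) :
    ∃ i, ∀ b, {n ∈ C | x n i = b}.Infinite := by
  classical
  by_contra! hfin
  have hev : ∀ i, ∃ b, ∃ N, ∀ n ∈ C, N < n → x n i = !b := by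
    intro i
    obtain ⟨b, hb⟩ := hfin i
    obtain ⟨N, hN⟩ := hb.bddAbove
    refine ⟨b, N, fun n hn hlt => ?_⟩
    have : x n i ≠ b := fun hnb => absurd (hN ⟨hn, hnb⟩) (not_le.2 hlt)
    cases b <;> simpa using this
  choose b N hN using hev
  set M := Finset.univ.sup N
  have hsame : ∀ n ∈ C, M < n → x n = fun i => !b i := fun n hn hlt => by
    funext i
    exact hN i n hn ((Finset.le_sup (Finset.mem_univ i)).trans_lt hlt)
  obtain ⟨m, hm, hMm⟩ := hC.exists_gt M
  have hex : ∃ n, n ∈ C ∧ m < n := hC.exists_gt m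
  set n := Nat.find hex
  obtain ⟨hn, hmn⟩ := Nat.find_spec hex
  obtain ⟨u, hu, hu'⟩ := hx (n + 1)
  have hlab : ∀ k ≤ n, labelAt (row e u) k = x k := fun k hk => hu' u le_rfl k (by omega)
  have hcomp := (good_row e u).compat hmn
    (by rw [hlab m hmn.le]; exact h.live_limit hx ((hCS m).1 hm))
    (by rw [hlab n le_rfl]; exact h.live_limit hx ((hCS n).1 hn)) fun k hmk hkn => by
      have hk : k ∉ C := fun hk => Nat.find_min hex hkn ⟨hk, hmk⟩
      rw [hCS] at hk
      push Not at hk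
      obtain ⟨c, hc⟩ := hk
      rw [hlab k hkn.le, h.limit_eq_const hx hc]
      exact not_live_const c
  rw [hlab m hmn.le, hlab n le_rfl, hsame m hm hMm, hsame n hn (hMm.trans hmn)] at hcomp
  exact hcomp.1 rfl

end Enumerates

theorem exists_separator {A B : Set ℕ} (hA : IsCE A) (hB : IsCE B) (hAB : A ∩ B = ∅)
    (hinf : (A ∪ B)ᶜ.Infinite) :
    ∃ X : Set ℕ, IsSeparator A B X ∧ HasCEDegree X ∧ ¬ EqStar X A ∧ ¬ EqStar Xᶜ B := by
  obtain ⟨a, ha, haA⟩ := hA.exists_primrec_stage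
  obtain ⟨b, hb, hbB⟩ := hB.exists_primrec_stage
  let e : Bool → ℕ → ℕ → Bool := fun c => cond c a b
  let S : Bool → Set ℕ := fun c => cond c A B
  have hdisj : ∀ {n}, n ∈ A → n ∉ B := fun {n} h h' => by
    have : n ∈ A ∩ B := ⟨h, h'⟩
    simp [hAB] at this
  have he : ∀ c, Primrec₂ (e c) := fun c => by cases c <;> assumption
  have hS : Enumerates e S := by
    refine ⟨fun c => by cases c <;> assumption, fun {c c' n} h h' => ?_⟩
    cases c <;> cases c' <;> first | rfl | exact absurd h (hdisj h') | exact absurd h' (hdisj h)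
  obtain ⟨x, hx⟩ := hS.exists_isLimit
  obtain ⟨i, hi⟩ := hS.exists_infinite hx hinf fun n => by simp [S, and_comm]
  refine ⟨{n | x n i = true}, ⟨fun n hn => ?_, fun n hn => ?_⟩,
    hS.hasCEDegree_limit hx he i, fun h => ?_, fun h => ?_⟩
  · have := hS.limit_eq_const hx (c := true) hn
    simp [this]
  · have := hS.limit_eq_const hx (c := false) hn
    simp [this]
  · refine hi true (h.subset fun n hn => Or.inl ⟨hn.2, fun hnA => hn.1 (Or.inl hnA)⟩)
  · refine hi false (h.subset fun n hn => Or.inl ⟨?_, fun hnB => hn.1 (Or.inr hnB)⟩)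
    simp [hn.2]

theorem mainTheorem1 :
    (∀ A B : Set ℕ, IsCE A → IsCE B → A ∩ B = ∅ → (A ∪ B)ᶜ.Infinite →
      ∃ X : Set ℕ, IsSeparator A B X ∧ HasCEDegree X ∧ ¬ EqStar X A ∧ ¬ EqStar Xᶜ B) ∧
    ¬ ∃ A B : Set ℕ, IsSuperMaximalPair A B := by
  refine ⟨fun A B => exists_separator, fun ⟨A, B, h⟩ => ?_⟩
  obtain ⟨X, hX, hdeg, h₁, h₂⟩ :=
    exists_separator h.ce_left h.ce_right h.disjoint h.infinite_compl
  exact (h.eqStar_of_separator X hdeg hX).elim h₁ h₂
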